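/- Let $p$ be an odd prime. Let $\mathfrak g$ be a complex semisimple Lie algebra with Cartan subalgebra $\mathfrak t$, root system $\Phi$, simple roots $\Pi=\{\delta_1,\dots,\delta_l\}$, positive roots $\Phi^+$, and Chevalley basis with root vectors $X_\alpha$ ($\alpha\in\Phi$). Let $V$ be a faithful finite-dimensional representation of $\mathfrak g$ whose weights generate the lattice of all integral weights, with an admissible lattice $V_{\mathbb Z}$ having a basis of weight vectors, so that $(X_\alpha^k/k!)V_{\mathbb Z}\subseteq V_{\mathbb Z}$ for all $\alpha,k$; this defines a simply connected Chevalley group, with elements $x_\alpha(t)=\sum_k t^k X_\alpha^k/k!$, $w_\alpha(t)=x_\alpha(t)x_{-\alpha}(-t^{-1})x_\alpha(t)$ and $h_\alpha(t)=w_\alpha(t)w_\alpha(1)^{-1}$. For $\alpha_1,\alpha_2\in\Phi$ with $\alpha_1+\alpha_2\neq0$ let $c_{ij}=c_{ij}(\alpha_1,\alpha_2)\in\mathbb Z$ be the constants of Chevalley's commutator formula $$x_{\alpha_1}(t)x_{\alpha_2}(u)=\Big(\prod_{i,j>0}x_{i\alpha_1+j\alpha_2}(c_{ij}t^iu^j)\Big)x_{\alpha_2}(u)x_{\alpha_1}(t)\qquad(t,u\in\mathbb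 Q_p),$$ the product being over the roots of the form $i\alpha_1+j\alpha_2$ with integers $i,j>0$, in an arbitrary fixed order. For $\alpha\in\Phi^+$ let $n_i=n_i(\alpha)\in\mathbb Z$ be given by $h_\alpha(t)=\prod_{i=1}^l h_{\delta_i}(t^{n_i})$ for $t\in\mathbb Q_p^\times$. Put $\langle\alpha,\delta\rangle=2(\alpha,\delta)/(\delta,\delta)$, $P=\log(1+p^2)/\log(1+p)\in\mathbb Z_p$ and $Q=(1+p^2)^{-1}\in\mathbb Z_p$. Let $\mathcal A$ be the ring of non-commutative formal power series over $\mathbb Z_p$ in the variables $V_\alpha$ $(\alpha\in\Phi)$ and $W_\delta$ $(\delta\in\Pi)$, with the topology given by the powers of its maximal ideal, which is generated by $p$ and the variables. For a variable $x$ and $a\in\mathbb Z_p$ write $(1+x)^a=\sum_{k\ge0}\binom akx^k$. Let $\mathcal R$ be the closed two-sided ideal of $\mathcal A$ generated by the relations 1. $(1+W_\delta)(1+V_\alpha)=(1+V_\alpha)^{(1+p)^{\langle\alpha,\delta\rangle}}(1+W_\delta)$ for $\alpha\in\Phi$, $\delta\in\Pi$; 2. $(1+V_{\alpha_1})(1+V_{\alpha_2})=(1+V_{\alpha_2})(1+V_{\alpha_1})$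 for $\alpha_1,\alpha_2\in\Phi$ with $\alpha_1+\alpha_2\notin\Phi\cup\{0\}$; 3. $(1+V_{\alpha_1})(1+V_{\alpha_2})=\Big(\prod_{i,j>0}(1+V_{i\alpha_1+j\alpha_2})^{c_{ij}p^{i+j-1}}\Big)(1+V_{\alpha_2})(1+V_{\alpha_1})$ for $\alpha_1,\alpha_2\in\Phi$ with $\alpha_1+\alpha_2\in\Phi$; 4. $(1+V_\alpha)(1+V_{-\alpha})=(1+V_{-\alpha})^Q\Big(\prod_{i=1}^l(1+W_{\delta_i})^{n_iP}\Big)(1+V_\alpha)^Q$ for $\alpha\in\Phi^+$; 5. $(1+W_\delta)(1+W_{\delta'})=(1+W_{\delta'})(1+W_\delta)$ for $\delta,\delta'\in\Pi$. Let $\overline{\mathcal A}$ be the ring of non-commutative formal power series over $\mathbb F_p$ in the same variables, $\mathcal M$ its maximal ideal (the series with zero constant term), $\overline{\mathcal R}\subset\overline{\mathcal A}$ the image of $\mathcal R$ under reduction modulo $p$, $\overline{\mathcal B}=\overline{\mathcal A}/\overline{\mathcal R}$, $F^n\overline{\mathcal B}$ the image of $\mathcal M^n$ in $\overline{\mathcal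 B}$, and $\operatorname{gr}^n\overline{\mathcal B}=F^n\overline{\mathcal B}/F^{n+1}\overline{\mathcal B}$. Let $S_n$ be the space of homogeneous commutative polynomials of degree $n$ over $\mathbb F_p$ in the variables $V_\alpha$ $(\alpha\in\Phi)$ and $W_\delta$ $(\delta\in\Pi)$. Then for every $n\ge0$, $$\dim_{\mathbb F_p}\operatorname{gr}^n\overline{\mathcal B}\le\dim_{\mathbb F_p}S_n .$$ -/

import Mathlib

/-! ### Non-commutative formal power series -/

/-- Formal power series with coefficients in `R` in the non-commuting variables `σ`: the series
`∑ a_w w`, where `w` runs over all words (lists) in `σ`, is encoded by its coefficients `w ↦ a_w`. -/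
def NCPowerSeries (σ : Type*) (R : Type*) : Type _ := List σ → R

namespace NCPowerSeries

@[ext] theorem ext {σ R : Type*} {f g : NCPowerSeries σ R} (h : ∀ w, f w = g w) : f = g := funext h

variable {σ R S : Type*} [CommRing R] [CommRing S]

instance : AddCommGroup (NCPowerSeries σ R) := inferInstanceAs (AddCommGroup (List σ → R))

instance : Module R (NCPowerSeries σ R) := inferInstanceAs (Module R (List σ → R))

theorem add_apply (f g : NCPowerSeries σ R) (w : List σ) : (f + g) w = f w + g w := rfl

theorem smul_apply (r : R) (f : NCPowerSeries σ R) (w : List σ) : (r • f) w = r * f w := rfl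

theorem zero_apply (w : List σ) : (0 : NCPowerSeries σ R) w = 0 := rfl

/-- The series with constant term `r` and no other term. -/
def const (r : R) : NCPowerSeries σ R
  | [] => r
  | _ :: _ => 0

instance : One (NCPowerSeries σ R) := ⟨const 1⟩

theorem one_nil : (1 : NCPowerSeries σ R) [] = 1 := rfl

theorem one_cons (a : σ) (w : List σ) : (1 : NCPowerSeries σ R) (a :: w) = 0 := rfl

/-- Cauchy product: the coefficient of a word `w` in `f * g` is the sum of the products
`f u * g v` over all the ways to write `w` as a concatenation of words `u` and `v`. -/
instance : Mul (NCPowerSeries σ R) :=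
  ⟨fun f g w => ∑ i ∈ Finset.range (w.length + 1), f (w.take i) * g (w.drop i)⟩

theorem mul_apply (f g : NCPowerSeries σ R) (w : List σ) :
    (f * g) w = ∑ i ∈ Finset.range (w.length + 1), f (w.take i) * g (w.drop i) := rfl

theorem mul_nil (f g : NCPowerSeries σ R) : (f * g) [] = f [] * g [] := by
  simp [mul_apply]

/-- The series `w ↦ f (a :: w)`. -/
def tail (a : σ) (f : NCPowerSeries σ R) : NCPowerSeries σ R := fun w => f (a :: w)

theorem mul_cons (f g : NCPowerSeries σ R) (a : σ) (w : List σ) :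
    (f * g) (a :: w) = f [] * g (a :: w) + (tail a f * g) w := by
  rw [mul_apply, mul_apply, List.length_cons, Finset.sum_range_succ' _ (w.length + 1), add_comm]
  rfl

theorem add_mul_aux (f g h : NCPowerSeries σ R) : (f + g) * h = f * h + g * h := by
  ext w
  simp [mul_apply, add_apply, add_mul, Finset.sum_add_distrib]

theorem mul_add_aux (f g h : NCPowerSeries σ R) : f * (g + h) = f * g + f * h := by
  ext w
  simp [mul_apply, add_apply, mul_add, Finset.sum_add_distrib]

theorem smul_mul_aux (r : R) (f g : NCPowerSeries σ R) : (r • f) * g = r • (f * g) := by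
  ext w
  simp [mul_apply, smul_apply, mul_assoc, Finset.mul_sum]

theorem mul_smul_aux (r : R) (f g : NCPowerSeries σ R) : f * (r • g) = r • (f * g) := by
  ext w
  simp [mul_apply, smul_apply, mul_left_comm, Finset.mul_sum]

theorem tail_mul (f g : NCPowerSeries σ R) (a : σ) :
    tail a (f * g) = f [] • tail a g + tail a f * g := by
  ext w
  exact mul_cons f g a w

theorem mul_assoc_aux (f g h : NCPowerSeries σ R) : f * g * h = f * (g * h) := by
  ext w
  induction w generalizing f g h with
  | nil => simp [mul_nil, mul_assoc]
  | cons a w ih =>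
    rw [mul_cons, mul_cons, mul_cons, tail_mul, add_mul_aux, add_apply, ih, smul_mul_aux,
      smul_apply, mul_nil]
    ring

theorem one_mul_aux (f : NCPowerSeries σ R) : 1 * f = f := by
  ext w
  cases w with
  | nil => simp [mul_nil, one_nil]
  | cons a w =>
    have h : tail a (1 : NCPowerSeries σ R) = 0 := rfl
    rw [mul_cons, h, mul_apply]
    simp [one_nil, zero_apply]

theorem mul_one_aux (f : NCPowerSeries σ R) : f * 1 = f := by
  ext w
  induction w generalizing f with
  | nil => simp [mul_nil, one_nil]
  | cons a w ih => rw [mul_cons, ih, one_cons]; simp [tail]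

instance : Ring (NCPowerSeries σ R) :=
  { (inferInstance : AddCommGroup (NCPowerSeries σ R)) with
    mul := (· * ·)
    one := 1
    left_distrib := mul_add_aux
    right_distrib := add_mul_aux
    zero_mul := fun f => by ext w; simp [mul_apply, zero_apply]
    mul_zero := fun f => by ext w; simp [mul_apply, zero_apply]
    mul_assoc := mul_assoc_aux
    one_mul := one_mul_aux
    mul_one := mul_one_aux }

instance : Algebra R (NCPowerSeries σ R) :=
  Algebra.ofModule smul_mul_aux mul_smul_aux

open Classical in
/-- The variable `x`, as a series. -/
noncomputable def X (x : σ) : NCPowerSeries σ R := fun w => if w = [x] then 1 else 0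

open Classical in
/-- The binomial series `(1 + x) ^ a = ∑ k, (a choose k) x ^ k` in one of the variables, with
exponent `a` in the coefficient ring. -/
noncomputable def onePlusPow [BinomialRing R] (x : σ) (a : R) : NCPowerSeries σ R :=
  fun w => if w = List.replicate w.length x then Ring.choose a w.length else 0

/-- The constant coefficient. -/
def constCoeff : NCPowerSeries σ R →+* R where
  toFun f := f []
  map_one' := rfl
  map_mul' := mul_nil
  map_zero' := rfl
  map_add' _ _ := rfl

/-- The maximal ideal: the series whose constant coefficient lies in the maximal ideal of `R`. -/
def maxIdeal (σ R : Type*) [CommRing R] [IsLocalRing R] : Ideal (NCPowerSeries σ R) :=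
  (IsLocalRing.maximalIdeal R).comap constCoeff

instance [IsLocalRing R] : (maxIdeal σ R).IsTwoSided :=
  inferInstanceAs ((IsLocalRing.maximalIdeal R).comap constCoeff).IsTwoSided

/-- Apply a ring homomorphism to all the coefficients. -/
def map (φ : R →+* S) : NCPowerSeries σ R →+* NCPowerSeries σ S where
  toFun f w := φ (f w)
  map_one' := by
    ext w
    cases w with
    | nil => exact φ.map_one
    | cons a w => exact φ.map_zero
  map_mul' f g := by
    ext w
    exact (map_sum φ _ _).trans (Finset.sum_congr rfl fun i _ => φ.map_mul _ _)
  map_zero' := by ext w; exact φ.map_zero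
  map_add' f g := by ext w; exact φ.map_add _ _

instance (φ : R →+* S) [RingHomSurjective φ] :
    RingHomSurjective (map φ : NCPowerSeries σ R →+* NCPowerSeries σ S) :=
  ⟨fun g => ⟨fun w => (φ.surjective (g w)).choose, by
    ext w
    exact (φ.surjective (g w)).choose_spec⟩⟩

end NCPowerSeries

/-- `J` is closed for the topology on the ring `A` given by the powers of the ideal `M`. -/
def IsAdicClosed {A : Type*} [Ring A] (M J : Ideal A) : Prop :=
  ∀ f : A, (∀ N : ℕ, ∃ g ∈ J, f - g ∈ M ^ N) → f ∈ J

/-- The closed two-sided ideal generated by the set `s`, for the topology on the ring `A` given by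
the powers of the ideal `M`. -/
def closedIdealSpan {A : Type*} [Ring A] (M : Ideal A) (s : Set A) : Ideal A :=
  sInf {J | J.IsTwoSided ∧ IsAdicClosed M J ∧ s ⊆ J}

instance {A : Type*} [Ring A] (M : Ideal A) (s : Set A) : (closedIdealSpan M s).IsTwoSided where
  mul_mem_of_left {a} b ha := by
    simp only [closedIdealSpan, Submodule.mem_sInf] at ha ⊢
    intro J hJ
    exact hJ.1.mul_mem_of_left b (ha J hJ)

/-- Reduction modulo `p`, as a surjective homomorphism. -/
instance (p : ℕ) [Fact p.Prime] : RingHomSurjective (PadicInt.toZMod (p := p)) :=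
  ⟨ZMod.ringHom_surjective _⟩

/-! ### The `p`-adic constants -/

section Constants

variable (p : ℕ) [Fact p.Prime]

theorem isUnit_one_add_p_mul (a : ℤ_[p]) : IsUnit (1 + (p : ℤ_[p]) * a) := by
  rw [PadicInt.isUnit_iff]
  have h : ‖(p : ℤ_[p]) * a‖ < 1 := by
    rw [norm_mul, PadicInt.norm_p]
    have h2 : (1 : ℝ) < p := by exact_mod_cast (Fact.out : p.Prime).one_lt
    calc (p : ℝ)⁻¹ * ‖a‖ ≤ (p : ℝ)⁻¹ * 1 := by gcongr; exact PadicInt.norm_le_one a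
      _ < 1 := by rw [mul_one]; exact inv_lt_one_of_one_lt₀ h2
  rw [PadicInt.norm_add_eq_max_of_ne (by rw [norm_one]; exact h.ne'), norm_one, max_eq_left h.le]

/-- `1 + p`, as a unit of `ℤ_p`. -/
noncomputable def unitOnePlusP : ℤ_[p]ˣ :=
  IsUnit.unit (a := 1 + (p : ℤ_[p])) (by simpa using isUnit_one_add_p_mul p 1)

/-- `1 + p ^ 2`, as a unit of `ℤ_p`. -/
noncomputable def unitOnePlusPSq : ℤ_[p]ˣ :=
  IsUnit.unit (a := 1 + (p : ℤ_[p]) ^ 2) (by simpa [sq] using isUnit_one_add_p_mul p p)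

/-- The `p`-adic logarithm `log (1 + x) = ∑ (-1) ^ (m + 1) x ^ m / m`, for `‖x‖ < 1`. -/
noncomputable def padicLogOnePlus (x : ℚ_[p]) : ℚ_[p] :=
  ∑' m : ℕ, (-1) ^ m * x ^ (m + 1) / (m + 1)

open Classical in
/-- `P = log (1 + p ^ 2) / log (1 + p)`, which is an element of `ℤ_p`. -/
noncomputable def exponentP : ℤ_[p] :=
  if h : ‖padicLogOnePlus p ((p : ℚ_[p]) ^ 2) / padicLogOnePlus p (p : ℚ_[p])‖ ≤ 1 then
    ⟨padicLogOnePlus p ((p : ℚ_[p]) ^ 2) / padicLogOnePlus p (p : ℚ_[p]), h⟩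
  else 0

/-- `Q = (1 + p ^ 2)⁻¹`. -/
noncomputable def exponentQ : ℤ_[p] := ((unitOnePlusPSq p)⁻¹ : ℤ_[p]ˣ)

end Constants

/-! ### Simply connected Chevalley groups -/

section Chevalley

open LieAlgebra.IsKilling

variable {L : Type*} [LieRing L] [LieAlgebra ℂ L] [FiniteDimensional ℂ L] [LieAlgebra.IsKilling ℂ L]
  (H : LieSubalgebra ℂ L) [H.IsCartanSubalgebra]

/-- The root `-α`. -/
noncomputable def negRoot {H : LieSubalgebra ℂ L} [H.IsCartanSubalgebra] (α : H.root) : H.root :=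
  (rootSystem H).reflectionPerm α α

/-- The lattice of integral weights: the linear forms on the Cartan subalgebra which are integral on
all coroots. -/
def integralWeights : AddSubgroup (Module.Dual ℂ H) where
  carrier := {wt | ∀ α : H.root, ∃ m : ℤ, wt ((rootSystem H).coroot α) = m}
  zero_mem' _ := ⟨0, by simp⟩
  add_mem' {x y} hx hy α := by
    obtain ⟨a, ha⟩ := hx α
    obtain ⟨c, hc⟩ := hy α
    exact ⟨a + c, by rw [LinearMap.add_apply, ha, hc, Int.cast_add]⟩
  neg_mem' {x} hx α := by
    obtain ⟨a, ha⟩ := hx α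
    exact ⟨-a, by rw [LinearMap.neg_apply, ha, Int.cast_neg]⟩

/-- The data which define a simply connected Chevalley group scheme inside `GL_n`: a Chevalley basis
of a complex semisimple Lie algebra `L`, and an admissible lattice in a representation `V` of `L`
whose weights generate the lattice of all integral weights. -/
structure ChevalleyDatum (V : Type*) [AddCommGroup V] [Module ℂ V] [LieRingModule L V]
    [LieModule ℂ L V] (n : ℕ) where
  /-- The root vectors of the Chevalley basis. -/
  rootVec : H.root → L
  rootVec_mem : ∀ α : H.root, rootVec α ∈ LieAlgebra.rootSpace H (α : LieModule.Weight ℂ H L)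
  lie_negRoot : ∀ α, ⁅rootVec α, rootVec (negRoot α)⁆ = ((rootSystem H).coroot α : L)
  /-- `[X_α, X_β] = ± (v + 1) X_(α + β)`, where `v` is the largest integer such that `β - v α` is a
  root. -/
  lie_add : ∀ α β γ, (rootSystem H).root γ = (rootSystem H).root α + (rootSystem H).root β →
    ⁅rootVec α, rootVec β⁆ = ((rootSystem H).chainBotCoeff α β + 1) • rootVec γ ∨
    ⁅rootVec α, rootVec β⁆ = -(((rootSystem H).chainBotCoeff α β + 1) • rootVec γ)
  /-- A basis of the lattice. -/
  basis : Module.Basis (Fin n) ℂ V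
  /-- The weights of the basis vectors. -/
  weight : Fin n → Module.Dual ℂ H
  lie_basis : ∀ (h : H) (i : Fin n), ⁅(h : L), basis i⁆ = weight i h • basis i
  /-- The integral matrix of the action of `X_α ^ k / k!` on the lattice. -/
  divPow : H.root → ℕ → Matrix (Fin n) (Fin n) ℤ
  factorial_smul_divPow : ∀ α k, k.factorial • (divPow α k).map (Int.cast : ℤ → ℂ) =
    LinearMap.toMatrix basis basis (LieModule.toEnd ℂ L V (rootVec α) ^ k)
  simplyConnected : AddSubgroup.closure (Set.range weight) = integralWeights H

namespace ChevalleyDatum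

variable {H} {V : Type*} [AddCommGroup V] [Module ℂ V] [LieRingModule L V] [LieModule ℂ L V] {n : ℕ}
  (D : ChevalleyDatum H V n) {K : Type*} [Field K]

/-- The root element `x_α(t) = ∑ t ^ k (X_α ^ k / k!)`; the sum stops at `k = n`, since `X_α` is
nilpotent on the `n`-dimensional space `V`. -/
noncomputable def x (α : H.root) (t : K) : Matrix (Fin n) (Fin n) K :=
  ∑ k ∈ Finset.range (n + 1), t ^ k • (D.divPow α k).map (Int.cast : ℤ → K)

/-- `w_α(t) = x_α(t) x_(-α)(-t⁻¹) x_α(t)`. -/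
noncomputable def w (α : H.root) (t : K) : Matrix (Fin n) (Fin n) K :=
  D.x α t * D.x (negRoot α) (-t⁻¹) * D.x α t

/-- `h_α(t) = w_α(t) w_α(1)⁻¹`. -/
noncomputable def h (α : H.root) (t : K) : Matrix (Fin n) (Fin n) K :=
  D.w α t * (D.w α 1)⁻¹

variable (p : ℕ) [Fact p.Prime]

/-- The integers `c_ij` of Chevalley's commutator formula
`x_α(t) x_β(u) = (∏ x_(iα+jβ)(c_ij t ^ i u ^ j)) x_β(u) x_α(t)`; the list `l` consists of the
triples `(i, j, iα + jβ)` with `i, j > 0`, in the order chosen for the product. -/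
noncomputable def commConst (l : List (ℕ × ℕ × H.root)) (α β : H.root) : ℕ → ℕ → ℤ :=
  Classical.epsilon fun c => ∀ t u : ℚ_[p],
    D.x α t * D.x β u =
      (l.map fun z => D.x z.2.2 ((c z.1 z.2.1 : ℚ_[p]) * t ^ z.1 * u ^ z.2.1)).prod *
        (D.x β u * D.x α t)

/-- The integers `n_i` in the decomposition `h_α(t) = ∏ h_(δ i)(t ^ n_i)` over the simple roots. -/
noncomputable def corootConst {l : ℕ} (δ : Fin l → H.root) (α : H.root) : Fin l → ℤ :=
  Classical.epsilon fun m => ∀ t : ℚ_[p], t ≠ 0 →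
    D.h α t = (List.ofFn fun i => D.h (δ i) (t ^ m i)).prod

end ChevalleyDatum

/-- For each pair of roots `α`, `β` with `α + β ≠ 0`, the list `terms α β` enumerates, in some order,
the triples `(i, j, γ)` such that `i, j > 0` and `γ = iα + jβ` is a root. -/
def IsCommutatorOrdering (terms : H.root → H.root → List (ℕ × ℕ × H.root)) : Prop :=
  ∀ α β, (rootSystem H).root α + (rootSystem H).root β ≠ 0 → (terms α β).Nodup ∧
    ∀ i j γ, (i, j, γ) ∈ terms α β ↔
      0 < i ∧ 0 < j ∧ (rootSystem H).root γ = i • (rootSystem H).root α + j • (rootSystem H).root β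

end Chevalley

/-! ### The relations and the algebra `𝓑` over `𝔽_p` -/

section Presentation

open LieAlgebra.IsKilling NCPowerSeries

variable (p : ℕ) [Fact p.Prime]
  {L : Type*} [LieRing L] [LieAlgebra ℂ L] [FiniteDimensional ℂ L] [LieAlgebra.IsKilling ℂ L]
  {H : LieSubalgebra ℂ L} [H.IsCartanSubalgebra]
  {V : Type*} [AddCommGroup V] [Module ℂ V] [LieRingModule L V] [LieModule ℂ L V] {n : ℕ}
  (D : ChevalleyDatum H V n) (b : (rootSystem H).Base)
  {l : ℕ} (δ : Fin l ≃ b.support) (terms : H.root → H.root → List (ℕ × ℕ × H.root))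

/-- The variables: `Sum.inl α` is `V_α` for a root `α`, and `Sum.inr d` is `W_d` for a simple
root `d`. -/
abbrev ChevalleyVars (b : (rootSystem H).Base) : Type _ := H.root ⊕ b.support

/-- The series `lhs - rhs`, for the relations `lhs = rhs` between the variables. -/
inductive IsChevalleyRelation : NCPowerSeries (ChevalleyVars b) ℤ_[p] → Prop
  | torus_root (d : b.support) (α : H.root) : IsChevalleyRelation
      ((1 + X (.inr d)) * (1 + X (.inl α)) -
        onePlusPow (.inl α) ((unitOnePlusP p ^ (rootSystem H).pairingIn ℤ α d : ℤ_[p]ˣ) : ℤ_[p]) *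
          (1 + X (.inr d)))
  | root_comm (α β : H.root) (hne : (rootSystem H).root α + (rootSystem H).root β ≠ 0)
      (hadd : (rootSystem H).root α + (rootSystem H).root β ∉ Set.range (rootSystem H).root) :
      IsChevalleyRelation
        ((1 + X (.inl α)) * (1 + X (.inl β)) - (1 + X (.inl β)) * (1 + X (.inl α)))
  | root_root (α β : H.root) (hne : (rootSystem H).root α + (rootSystem H).root β ≠ 0)
      (hadd : (rootSystem H).root α + (rootSystem H).root β ∈ Set.range (rootSystem H).root) :
      IsChevalleyRelation
        ((1 + X (.inl α)) * (1 + X (.inl β)) -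
          ((terms α β).map fun z => onePlusPow (.inl z.2.2)
            ((D.commConst p (terms α β) α β z.1 z.2.1 : ℤ_[p]) *
              (p : ℤ_[p]) ^ (z.1 + z.2.1 - 1))).prod *
          ((1 + X (.inl β)) * (1 + X (.inl α))))
  | root_neg (α : H.root) (hpos : b.IsPos α) : IsChevalleyRelation
      ((1 + X (.inl α)) * (1 + X (.inl (negRoot α))) -
        onePlusPow (.inl (negRoot α)) (exponentQ p) *
          (List.ofFn fun i : Fin l => onePlusPow (.inr (δ i))
            ((D.corootConst p (fun k => (δ k : H.root)) α i : ℤ_[p]) * exponentP p)).prod *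
          onePlusPow (.inl α) (exponentQ p))
  | torus_torus (d d' : b.support) : IsChevalleyRelation
      ((1 + X (.inr d)) * (1 + X (.inr d')) - (1 + X (.inr d')) * (1 + X (.inr d)))

/-- The closed two-sided ideal `𝓡` generated by the relations. -/
noncomputable def idealR : Ideal (NCPowerSeries (ChevalleyVars b) ℤ_[p]) :=
  closedIdealSpan (maxIdeal (ChevalleyVars b) ℤ_[p]) {f | IsChevalleyRelation p D b δ terms f}

noncomputable instance : (idealR p D b δ terms).IsTwoSided :=
  inferInstanceAs (closedIdealSpan _ _).IsTwoSided

/-- The image of `𝓡` under reduction of the coefficients modulo `p`. As the reduction is surjective,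
the ideal generated by the image is the image itself. -/
noncomputable def idealRbar : Ideal (NCPowerSeries (ChevalleyVars b) (ZMod p)) :=
  (idealR p D b δ terms).map (NCPowerSeries.map PadicInt.toZMod)

noncomputable instance : (idealRbar p D b δ terms).IsTwoSided :=
  inferInstanceAs (Ideal.map _ (idealR p D b δ terms)).IsTwoSided

/-- The quotient algebra over `𝔽_p`. -/
abbrev AlgBbar : Type _ := NCPowerSeries (ChevalleyVars b) (ZMod p) ⧸ idealRbar p D b δ terms

/-- The `N`-th step of the filtration of the quotient: the image of the `N`-th power of the maximal
ideal. -/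
noncomputable def filtBbar (N : ℕ) : Submodule (ZMod p) (AlgBbar p D b δ terms) :=
  ((maxIdeal (ChevalleyVars b) (ZMod p) ^ N).restrictScalars (ZMod p)).map
    (Ideal.Quotient.mkₐ (ZMod p) (idealRbar p D b δ terms)).toLinearMap

/-- The `N`-th graded piece of the filtration. -/
abbrev grBbar (N : ℕ) : Type _ :=
  filtBbar p D b δ terms N ⧸
    (filtBbar p D b δ terms (N + 1)).comap (filtBbar p D b δ terms N).subtype

end Presentation

/-!
Write `𝓜` for the maximal ideal of the power series over `𝔽_p` and `𝓡` for the ideal of relations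
reduced modulo `p`. All the defining relations are deformations of commutation relations: the
exponents occurring in them are congruent modulo `p` to `1` (namely `(1 + p) ^ ⟨α, δ⟩` and `Q`) or to
`0` (namely `c_ij p ^ (i + j - 1)`, as `i + j ≥ 2`, and `n_i P`, as `log (1 + x)` has the same norm
as `x`, so that `P` has norm `1 / p`). Whatever the integers `c_ij` and `n_i` are, the binomial series
with such exponents reduce modulo `p` to `1 + x` or to `1`, up to terms of order at least three; the
quadratic term `a (a - 1) / 2` disappears because `p` is odd (`map_onePlusPow_sub_mem`). Hence any two
variables commute modulo `𝓡 + 𝓜 ^ 3` (`commutator_mem_idealRbar_sup`).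

Interchanging two adjacent letters of a word of length `N` therefore changes it by an element of
`𝓡 + 𝓜 ^ (N + 1)` only, so its class in the `N`-th graded piece depends only on the commutative
monomial underlying the word (`word_sub_word_mem_of_perm`). As the words of length `N` span
`𝓜 ^ N / 𝓜 ^ (N + 1)`, the graded piece is spanned by one element for each commutative monomial of
degree `N`, and these monomials are linearly independent polynomials (`rank_graded_quotient_le`).
-/

/-! ### Words and powers of the maximal ideal -/

/-- The sum of two two-sided ideals is two-sided. -/
theorem Ideal.isTwoSided_sup {A : Type*} [Ring A] (I J : Ideal A) [I.IsTwoSided] [J.IsTwoSided] :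
    (I ⊔ J).IsTwoSided where
  mul_mem_of_left {a} c ha := by
    obtain ⟨i, hi, j, hj, rfl⟩ := Submodule.mem_sup.1 ha
    rw [add_mul]
    exact Submodule.add_mem_sup (I.mul_mem_right c hi) (J.mul_mem_right c hj)

namespace NCPowerSeries

variable {σ k : Type*}

section CommRing

variable [CommRing k]

theorem sub_apply (f g : NCPowerSeries σ k) (w : List σ) : (f - g) w = f w - g w := rfl

theorem sum_apply {ι : Type*} (s : Finset ι) (f : ι → NCPowerSeries σ k) (w : List σ) :
    (∑ i ∈ s, f i) w = ∑ i ∈ s, f i w :=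
  Finset.sum_apply w s f

theorem X_nil (a : σ) : (X a : NCPowerSeries σ k) [] = 0 := by simp [X]

open Classical in
theorem tail_X (a c : σ) : tail c (X a : NCPowerSeries σ k) = if c = a then 1 else 0 := by
  ext w
  by_cases h : c = a <;> cases w <;> simp [tail, X, h, one_nil, one_cons, zero_apply]

open Classical in
theorem X_mul_cons (a c : σ) (f : NCPowerSeries σ k) (w : List σ) :
    (X a * f : NCPowerSeries σ k) (c :: w) = if c = a then f w else 0 := by
  rw [mul_cons, X_nil, tail_X]
  split_ifs <;> simp [zero_apply]

/-- The monomial of a word, as a series. -/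
noncomputable def word (w : List σ) : NCPowerSeries σ k := (w.map X).prod

theorem word_cons (a : σ) (w : List σ) :
    (word (a :: w) : NCPowerSeries σ k) = X a * word w := by
  simp [word]

open Classical in
theorem word_apply (w u : List σ) : (word w : NCPowerSeries σ k) u = if u = w then 1 else 0 := by
  induction w generalizing u with
  | nil => cases u <;> simp [word, one_nil, one_cons]
  | cons a w ih =>
    rw [word_cons]
    cases u with
    | nil => simp [mul_nil, X_nil]
    | cons c u =>
      rw [X_mul_cons, ih]
      by_cases h : c = a <;> simp [h]

theorem map_X {S : Type*} [CommRing S] (φ : k →+* S) (x : σ) :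
    map φ (X x) = X x := by
  ext w
  change φ (X x w) = _
  rw [X, X]
  split_ifs <;> simp

theorem eq_sum_X_mul_tail [Fintype σ] (f : NCPowerSeries σ k) (hf : f [] = 0) :
    f = ∑ a, (X a * tail a f : NCPowerSeries σ k) := by
  classical
  ext w
  rw [sum_apply]
  cases w with
  | nil => simp [mul_nil, X_nil, hf]
  | cons c w => simp [X_mul_cons, tail]

end CommRing

section Field

variable [Field k]

theorem mem_maxIdeal_iff (f : NCPowerSeries σ k) : f ∈ maxIdeal σ k ↔ f [] = 0 := by
  rw [maxIdeal, IsLocalRing.maximalIdeal_eq_bot, Ideal.mem_comap, Ideal.mem_bot]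
  rfl

theorem X_mem_maxIdeal (a : σ) : (X a : NCPowerSeries σ k) ∈ maxIdeal σ k :=
  (mem_maxIdeal_iff _).2 (X_nil a)

/-- In finitely many variables over a field, the powers of the maximal ideal are the steps of the
filtration by the order of a series. -/
theorem mem_maxIdeal_pow_iff [Finite σ] (N : ℕ) (f : NCPowerSeries σ k) :
    f ∈ maxIdeal σ k ^ N ↔ ∀ w : List σ, w.length < N → f w = 0 := by
  have := Fintype.ofFinite σ
  constructor
  · induction N generalizing f with
    | zero => simp
    | succ N ih =>
      rw [Ideal.IsTwoSided.pow_succ]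
      intro hf
      induction hf using Submodule.mul_induction_on' with
      | add x _ y _ hx hy => intro w hw; rw [add_apply, hx w hw, hy w hw, add_zero]
      | mem_mul_mem g hg h hh =>
        intro w hw
        rw [mul_apply]
        refine Finset.sum_eq_zero fun i _ => ?_
        rcases Nat.eq_zero_or_pos i with rfl | hi
        · rw [List.take_zero, (mem_maxIdeal_iff g).1 hg, zero_mul]
        · by_cases hw0 : w = []
          · subst hw0
            rw [List.take_nil, (mem_maxIdeal_iff g).1 hg, zero_mul]
          · have := List.length_pos_iff.2 hw0
            rw [ih h hh _ (by rw [List.length_drop]; omega), mul_zero]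
  · induction N generalizing f with
    | zero => intro _; rw [Submodule.pow_zero, Ideal.one_eq_top]; trivial
    | succ N ih =>
      intro hf
      rw [eq_sum_X_mul_tail f (hf [] (Nat.succ_pos N)), Ideal.IsTwoSided.pow_succ]
      exact Submodule.sum_mem _ fun a _ => Ideal.mul_mem_mul (X_mem_maxIdeal a)
        (ih _ fun w hw => hf (a :: w) (by simpa using hw))

theorem word_mem_maxIdeal_pow [Finite σ] (w : List σ) :
    (word w : NCPowerSeries σ k) ∈ maxIdeal σ k ^ w.length := by
  classical
  rw [mem_maxIdeal_pow_iff]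
  intro u hu
  rw [word_apply, if_neg]
  rintro rfl
  exact hu.false

/-- The words of length `N` span the `N`-th power of the maximal ideal modulo the next one. -/
theorem sub_sum_word_mem_maxIdeal_pow [Finite σ] (N : ℕ) (f : NCPowerSeries σ k)
    (hf : f ∈ maxIdeal σ k ^ N) :
    f - ∑ w ∈ (List.finite_length_eq σ N).toFinset, f w • word w ∈ maxIdeal σ k ^ (N + 1) := by
  classical
  rw [mem_maxIdeal_pow_iff] at hf ⊢
  intro u hu
  have hsum (S : Finset (List σ)) : (∑ w ∈ S, f w • word w : NCPowerSeries σ k) u =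
      if u ∈ S then f u else 0 := by
    rw [sum_apply, ← Finset.sum_ite_eq S u fun w => f w]
    exact Finset.sum_congr rfl fun w _ => by
      rw [smul_apply, word_apply, mul_ite, mul_one, mul_zero]
  rw [sub_apply, hsum]
  by_cases h : u.length = N
  · rw [if_pos (by simpa using h), sub_self]
  · rw [if_neg (by simpa using h), hf u (by omega), sub_zero]

/-! ### Rearranging words modulo an ideal -/

/-- If the variables commute modulo `J + 𝓜 ^ 3`, then two words which are permutations of each other
agree modulo `J` and a power of `𝓜` exceeding their length: interchanging two adjacent letters costs
two letters and gains three. -/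
theorem word_sub_word_mem_of_perm [Finite σ] (J : Ideal (NCPowerSeries σ k)) [J.IsTwoSided]
    (hJ : ∀ a c : σ, X a * X c - X c * X a ∈ J ⊔ maxIdeal σ k ^ 3) {u v : List σ}
    (h : u.Perm v) : word u - word v ∈ J ⊔ maxIdeal σ k ^ (u.length + 1) := by
  induction h with
  | nil => simp
  | @cons a u v _ ih =>
    rw [word_cons, word_cons, ← mul_sub]
    obtain ⟨j, hj, m, hm, h⟩ := Submodule.mem_sup.1 ih
    rw [← h, mul_add, List.length_cons, Ideal.IsTwoSided.pow_succ]
    exact Submodule.add_mem_sup (J.mul_mem_left _ hj) (Ideal.mul_mem_mul (X_mem_maxIdeal a) hm)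
  | swap a c u =>
    obtain ⟨j, hj, m, hm, h⟩ := Submodule.mem_sup.1 (hJ c a)
    have : (word (c :: a :: u) - word (a :: c :: u) : NCPowerSeries σ k) = (j + m) * word u := by
      rw [h]
      simp only [word_cons]
      noncomm_ring
    rw [this, add_mul, List.length_cons, List.length_cons,
      show u.length + 1 + 1 + 1 = 3 + u.length by omega, Ideal.IsTwoSided.pow_add]
    exact Submodule.add_mem_sup (J.mul_mem_right _ hj)
      (Ideal.mul_mem_mul hm (word_mem_maxIdeal_pow u))
  | trans h₁ _ ih₁ ih₂ =>
    rw [← sub_add_sub_cancel]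
    rw [← h₁.length_eq] at ih₂
    exact add_mem ih₁ ih₂

/-- If the variables commute modulo `J + 𝓜 ^ 3`, then each graded piece of the quotient by `J` is
spanned by one word for each commutative monomial. -/
theorem rank_graded_quotient_le [Finite σ] (J : Ideal (NCPowerSeries σ k)) [J.IsTwoSided]
    (hJ : ∀ a c : σ, X a * X c - X c * X a ∈ J ⊔ maxIdeal σ k ^ 3)
    (F : ℕ → Submodule k (NCPowerSeries σ k ⧸ J))
    (hF : ∀ N, F N = ((maxIdeal σ k ^ N).restrictScalars k).map
      (Ideal.Quotient.mkₐ k J).toLinearMap) (N : ℕ) :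
    Module.rank k (F N ⧸ (F (N + 1)).comap (F N).subtype) ≤
      Module.rank k (MvPolynomial.homogeneousSubmodule σ k N) := by
  have hmem (M : ℕ) (f : NCPowerSeries σ k) (hf : f ∈ (maxIdeal σ k ^ M).restrictScalars k) :
      (Ideal.Quotient.mkₐ k J).toLinearMap f ∈ F M := by
    rw [hF]
    exact Submodule.mem_map_of_mem hf
  let q : (maxIdeal σ k ^ N).restrictScalars k →ₗ[k] F N ⧸ (F (N + 1)).comap (F N).subtype :=
    (Submodule.mkQ _).comp ((Ideal.Quotient.mkₐ k J).toLinearMap.restrict (hmem N))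
  have hq : Function.Surjective q := by
    refine (Submodule.mkQ_surjective _).comp ?_
    rintro ⟨y, hy⟩
    have hy' := hy
    rw [hF] at hy'
    obtain ⟨f, hf, rfl⟩ := hy'
    exact ⟨⟨f, hf⟩, rfl⟩
  have hq0 (d : (maxIdeal σ k ^ N).restrictScalars k)
      (hd : (d : NCPowerSeries σ k) ∈ J ⊔ maxIdeal σ k ^ (N + 1)) : q d = 0 := by
    refine (Submodule.Quotient.mk_eq_zero _).2 ?_
    obtain ⟨j, hj, m, hm, h⟩ := Submodule.mem_sup.1 hd
    have h1 : Ideal.Quotient.mk J (d : NCPowerSeries σ k) = Ideal.Quotient.mk J m := by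
      rw [← h, map_add, Ideal.Quotient.eq_zero_iff_mem.2 hj, zero_add]
    have h2 := hmem (N + 1) m hm
    change Ideal.Quotient.mk J (d : NCPowerSeries σ k) ∈ F (N + 1)
    rw [h1]
    exact h2
  -- One word is chosen for each commutative monomial of degree `N`.
  let I := {m : Multiset σ // m.card = N}
  have hword (w : List σ) (hw : w.length = N) :
      (word w : NCPowerSeries σ k) ∈ (maxIdeal σ k ^ N).restrictScalars k := by
    rw [← hw]
    exact word_mem_maxIdeal_pow w
  let c : I → (maxIdeal σ k ^ N).restrictScalars k := fun m =>
    ⟨word m.1.toList, hword _ (by rw [Multiset.length_toList, m.2])⟩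
  have hspan : Submodule.span k (Set.range (q ∘ c)) = ⊤ := by
    set T := Submodule.span k (Set.range (q ∘ c)) with hT
    let T' := (T.comap q).map ((maxIdeal σ k ^ N).restrictScalars k).subtype
    have hwT (w : List σ) (hw : w.length = N) : (word w : NCPowerSeries σ k) ∈ T' := by
      let m : I := ⟨(w : Multiset σ), by rw [Multiset.coe_card, hw]⟩
      refine ⟨⟨word w, hword w hw⟩, ?_, rfl⟩
      have hperm : w.Perm m.1.toList := by
        rw [← Multiset.coe_eq_coe, Multiset.coe_toList]
      have h := hq0 (⟨word w, hword w hw⟩ - c m) (by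
        have := word_sub_word_mem_of_perm J hJ hperm
        rwa [hw] at this)
      rw [map_sub, sub_eq_zero] at h
      change q _ ∈ T
      rw [h]
      exact Submodule.subset_span ⟨m, rfl⟩
    refine Submodule.eq_top_iff'.2 fun y => ?_
    obtain ⟨f, rfl⟩ := hq y
    have hsum : ∑ w ∈ (List.finite_length_eq σ N).toFinset, f.1 w • (word w : NCPowerSeries σ k) ∈
        T' := Submodule.sum_mem _ fun w hw =>
      Submodule.smul_mem _ _ (hwT w (by simpa using hw))
    obtain ⟨g, hg, hgf⟩ := hsum
    have h := hq0 (f - g) (by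
      have := sub_sum_word_mem_maxIdeal_pow N f.1 f.2
      rw [← hgf] at this
      exact Submodule.mem_sup_right this)
    rw [map_sub, sub_eq_zero] at h
    rw [h]
    exact hg
  classical
  have hind : LinearIndependent k fun m : I =>
      (⟨MvPolynomial.monomial (Multiset.toFinsupp m.1) 1,
        MvPolynomial.isHomogeneous_monomial 1
          ((Multiset.toFinsupp_sum_eq m.1).trans m.2)⟩ :
        MvPolynomial.homogeneousSubmodule σ k N) := by
    refine LinearIndependent.of_comp (Submodule.subtype _) ?_
    have h := (MvPolynomial.basisMonomials σ k).linearIndependent.comp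
      (fun m : I => Multiset.toFinsupp m.1)
      (Multiset.toFinsupp.injective.comp Subtype.val_injective)
    simpa [Function.comp_def] using h
  have h1 := rank_span_le (R := k) (Set.range (q ∘ c))
  rw [hspan, rank_top] at h1
  have h2 := Cardinal.mk_range_le_lift (f := q ∘ c)
  have h3 := hind.cardinal_lift_le_rank
  exact Cardinal.lift_le.1 ((Cardinal.lift_le.2 h1).trans (h2.trans h3))

end Field

end NCPowerSeries

/-! ### The `p`-adic exponents -/

section Exponents

open NCPowerSeries

variable (p : ℕ) [Fact p.Prime]

theorem PadicInt.toZMod_eq_zero_of_norm_lt_one {a : ℤ_[p]} (ha : ‖a‖ < 1) : toZMod a = 0 := by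
  rw [← RingHom.mem_ker, ker_toZMod, IsLocalRing.mem_maximalIdeal, mem_nonunits]
  exact ha

/-- The terms after the first of the logarithmic series are smaller than the first one, since
`m + 1 < 3 ^ m ≤ p ^ m` for `m ≥ 1`. -/
theorem norm_padicLogOnePlus (hp : p ≠ 2) {x : ℚ_[p]} (hx : ‖x‖ ≤ (p : ℝ)⁻¹) :
    ‖padicLogOnePlus p x‖ = ‖x‖ := by
  have hp3 : 3 ≤ p := by
    have := (Fact.out : p.Prime).two_le
    omega
  have hp3' : (p : ℝ)⁻¹ ≤ 3⁻¹ := by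
    gcongr
    exact_mod_cast hp3
  have hx3 : ‖x‖ ≤ 3⁻¹ := hx.trans hp3'
  have hterm (m : ℕ) : ‖(-1) ^ m * x ^ (m + 1) / ((m : ℚ_[p]) + 1)‖ ≤
      ‖x‖ * ((m + 1 : ℝ) * (3⁻¹ : ℝ) ^ m) := by
    have hm : ((m + 1 : ℕ) : ℝ)⁻¹ ≤ ‖((m + 1 : ℕ) : ℚ_[p])‖ := by
      rw [Padic.norm_eq_zpow_neg_valuation (by exact_mod_cast m.succ_ne_zero),
        Padic.valuation_natCast, zpow_neg, zpow_natCast]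
      have h : p ^ padicValNat p (m + 1) ≤ m + 1 := Nat.le_of_dvd m.succ_pos pow_padicValNat_dvd
      have h0 : 0 < p ^ padicValNat p (m + 1) := pow_pos (by omega) _
      exact inv_anti₀ (by exact_mod_cast h0) (by exact_mod_cast h)
    rw [norm_div, norm_mul, norm_pow, norm_neg, norm_one, one_pow, one_mul, norm_pow, pow_succ,
      div_eq_mul_inv]
    have h1 : ‖((m : ℚ_[p]) + 1)‖⁻¹ ≤ m + 1 := by
      rw [inv_le_comm₀ _ (by positivity)]
      · exact_mod_cast hm
      · exact norm_pos_iff.2 (by exact_mod_cast m.succ_ne_zero)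
    calc ‖x‖ ^ m * ‖x‖ * ‖((m : ℚ_[p]) + 1)‖⁻¹ ≤ 3⁻¹ ^ m * ‖x‖ * (m + 1) := by gcongr
      _ = _ := by ring
  have hsum : Summable fun m : ℕ => (-1) ^ m * x ^ (m + 1) / ((m : ℚ_[p]) + 1) := by
    refine Summable.of_norm_bounded ?_ hterm
    refine Summable.mul_left _ ?_
    have h1 := summable_pow_mul_geometric_of_norm_lt_one (R := ℝ) 1 (r := 3⁻¹) (by norm_num)
    have h0 := summable_geometric_of_norm_lt_one (K := ℝ) (x := 3⁻¹) (by norm_num)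
    refine (h1.add h0).congr fun m => by ring
  -- The sequence `m / 3 ^ (m - 1)` decreases for `m ≥ 2`, so its value `2 / 3` at `2` is the bound.
  have hsmall (m : ℕ) : ((m : ℝ) + 1 + 1) * 3⁻¹ ^ (m + 1) ≤ 2 / 3 := by
    induction m with
    | zero => norm_num
    | succ m ih =>
      have h : (0 : ℝ) < 3⁻¹ ^ (m + 1) := by positivity
      rw [pow_succ]
      push_cast
      nlinarith
  rcases eq_or_ne x 0 with rfl | hx0
  · simp [padicLogOnePlus]
  have hxpos : 0 < ‖x‖ := norm_pos_iff.2 hx0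
  rw [padicLogOnePlus, hsum.tsum_eq_zero_add]
  have hrest : ‖∑' m : ℕ, (-1) ^ (m + 1) * x ^ (m + 1 + 1) / (((m + 1 : ℕ) : ℚ_[p]) + 1)‖ ≤
      ‖x‖ * (2 / 3) := by
    refine IsUltrametricDist.norm_tsum_le_of_forall_le fun m => (hterm (m + 1)).trans ?_
    gcongr
    exact_mod_cast hsmall m
  have hlt : ‖x‖ * (2 / 3) < ‖x‖ := by linarith
  have h0 : (-1) ^ 0 * x ^ (0 + 1) / (((0 : ℕ) : ℚ_[p]) + 1) = x := by simp
  rw [h0, IsUltrametricDist.norm_add_eq_max_of_norm_ne_norm (hrest.trans_lt hlt).ne',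
    max_eq_left (hrest.trans hlt.le)]

theorem toZMod_exponentP (hp : p ≠ 2) : PadicInt.toZMod (exponentP p) = 0 := by
  have hp1 : (1 : ℝ) < p := by exact_mod_cast (Fact.out : p.Prime).one_lt
  have hpinv : (p : ℝ)⁻¹ < 1 := inv_lt_one_of_one_lt₀ hp1
  have hn : ‖padicLogOnePlus p ((p : ℚ_[p]) ^ 2) / padicLogOnePlus p (p : ℚ_[p])‖ < 1 := by
    rw [norm_div, norm_padicLogOnePlus p hp, norm_padicLogOnePlus p hp, norm_pow, Padic.norm_p, sq,
      mul_div_assoc, div_self (by positivity), mul_one]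
    · exact hpinv
    · rw [Padic.norm_p]
    · rw [norm_pow, Padic.norm_p, sq]
      exact mul_le_of_le_one_left (by positivity) hpinv.le
  have hP : exponentP p = ⟨_, hn.le⟩ := dif_pos hn.le
  rw [hP]
  exact PadicInt.toZMod_eq_zero_of_norm_lt_one p hn

theorem toZMod_exponentQ : PadicInt.toZMod (exponentQ p) = 1 := by
  have h := congrArg PadicInt.toZMod (unitOnePlusPSq p).inv_mul
  rw [map_mul, map_one] at h
  rw [unitOnePlusPSq, IsUnit.unit_spec] at h
  rw [map_add, map_pow, map_natCast, ZMod.natCast_self, zero_pow two_ne_zero, add_zero, map_one,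
    mul_one] at h
  exact h

theorem toZMod_unitOnePlusP_zpow (m : ℤ) :
    PadicInt.toZMod ((unitOnePlusP p ^ m : ℤ_[p]ˣ) : ℤ_[p]) = 1 := by
  have h : Units.map (PadicInt.toZMod (p := p)).toMonoidHom (unitOnePlusP p) = 1 := by
    ext
    simp [unitOnePlusP]
  have h2 := congrArg Units.val (map_zpow (Units.map (PadicInt.toZMod (p := p)).toMonoidHom)
    (unitOnePlusP p) m)
  rwa [h, one_zpow] at h2

/-- Modulo `p` and up to order two, the binomial series is `1 + x` or `1` when the exponent is
congruent to `1` or `0`: as `p` is odd, the quadratic coefficient `a (a - 1) / 2` vanishes. -/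
theorem map_onePlusPow_sub_mem (hp : p ≠ 2) {σ : Type*} [Finite σ] (x : σ) (a : ℤ_[p])
    (ha : PadicInt.toZMod a * (PadicInt.toZMod a - 1) = 0) :
    NCPowerSeries.map PadicInt.toZMod (onePlusPow x a) - (1 + PadicInt.toZMod a • X x) ∈
      maxIdeal σ (ZMod p) ^ 3 := by
  have h2 : PadicInt.toZMod (Ring.choose a 2) = 0 := by
    have h := congrArg PadicInt.toZMod (Ring.choose_smul_choose a (n := 2) (k := 1) (by norm_num))
    rw [show 2 - 1 = 1 from rfl, Nat.choose_one_right, Ring.choose_one_right, Ring.choose_one_right,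
      nsmul_eq_mul, map_mul, map_natCast, map_mul, map_sub, Nat.cast_one, map_one, ha] at h
    refine (mul_eq_zero.1 h).resolve_left fun h' => hp ?_
    rw [ZMod.natCast_eq_zero_iff] at h'
    exact (Nat.prime_dvd_prime_iff_eq Fact.out Nat.prime_two).1 h'
  classical
  rw [mem_maxIdeal_pow_iff]
  intro w hw
  rw [NCPowerSeries.sub_apply, NCPowerSeries.add_apply,
    NCPowerSeries.smul_apply]
  change PadicInt.toZMod (onePlusPow x a w) - _ = 0
  match w, hw with
  | [], _ => simp [onePlusPow, X, one_nil]
  | [y], _ => by_cases h : y = x <;> simp [onePlusPow, X, one_cons, h]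
  | [y, z], _ =>
    by_cases h : y = x ∧ z = x <;> simp [onePlusPow, X, one_cons, h, h2]

end Exponents

/-! ### The variables commute up to order three -/

theorem mul_comm_of_one_add_mul_comm {A : Type*} [Ring A] {a c : A}
    (h : (1 + a) * (1 + c) = (1 + c) * (1 + a)) : a * c = c * a := by
  have h1 : (1 + a) * (1 + c) - (1 + c) * (1 + a) = a * c - c * a := by noncomm_ring
  rw [← sub_eq_zero, ← h1, h, sub_self]

section Relations

open LieAlgebra.IsKilling NCPowerSeries

variable (p : ℕ) [Fact p.Prime]
  {L : Type*} [LieRing L] [LieAlgebra ℂ L] [FiniteDimensional ℂ L] [LieAlgebra.IsKilling ℂ L]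
  {H : LieSubalgebra ℂ L} [H.IsCartanSubalgebra]
  {V : Type*} [AddCommGroup V] [Module ℂ V] [LieRingModule L V] [LieModule ℂ L V] {n : ℕ}
  (D : ChevalleyDatum H V n) (b : (rootSystem H).Base)
  {l : ℕ} (δ : Fin l ≃ b.support) (terms : H.root → H.root → List (ℕ × ℕ × H.root))

theorem map_mem_idealRbar {f : NCPowerSeries (ChevalleyVars b) ℤ_[p]}
    (hf : IsChevalleyRelation p D b δ terms f) :
    NCPowerSeries.map PadicInt.toZMod f ∈ idealRbar p D b δ terms := by
  refine Ideal.mem_map_of_mem _ ?_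
  rw [idealR, closedIdealSpan, Submodule.mem_sInf]
  exact fun J hJ => hJ.2.2 hf

theorem root_negRoot (α : H.root) :
    (rootSystem H).root (negRoot α) = -(rootSystem H).root α := by
  rw [negRoot, RootPairing.root_reflectionPerm, RootPairing.reflection_apply_self]

theorem negRoot_negRoot (α : H.root) : negRoot (negRoot α) = α :=
  (rootSystem H).root.injective (by rw [root_negRoot, root_negRoot, neg_neg])

theorem isPos_or_isPos_negRoot (α : H.root) : b.IsPos α ∨ b.IsPos (negRoot α) :=
  RootPairing.Base.IsPos.or_neg b α

/-- Each defining relation, read modulo `p` and up to order two, says that two variables commute: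
the exponents `(1 + p) ^ ⟨α, δ⟩` and `Q` are `1` modulo `p`, while `c_ij p ^ (i + j - 1)` and
`n_i P` are divisible by `p`. -/
theorem commutator_mem_idealRbar_sup (hp : p ≠ 2) (hterms : IsCommutatorOrdering H terms)
    (x y : ChevalleyVars b) :
    X x * X y - X y * X x ∈
      idealRbar p D b δ terms ⊔ maxIdeal (ChevalleyVars b) (ZMod p) ^ 3 := by
  set J := idealRbar p D b δ terms ⊔ maxIdeal (ChevalleyVars b) (ZMod p) ^ 3 with hJ
  have : J.IsTwoSided := Ideal.isTwoSided_sup _ _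
  let π := (Ideal.Quotient.mk J).comp (NCPowerSeries.map (PadicInt.toZMod (p := p)))
  let v (z : ChevalleyVars b) := Ideal.Quotient.mk J (X z)
  have hX (z : ChevalleyVars b) : π (X z) = v z := by
    rw [RingHom.comp_apply, map_X]
  have hrel {f : NCPowerSeries (ChevalleyVars b) ℤ_[p]}
      (hf : IsChevalleyRelation p D b δ terms f) : π f = 0 :=
    Ideal.Quotient.eq_zero_iff_mem.2
      (Submodule.mem_sup_left (map_mem_idealRbar p D b δ terms hf))
  have hpow (z : ChevalleyVars b) (a : ℤ_[p])
      (ha : PadicInt.toZMod a * (PadicInt.toZMod a - 1) = 0) :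
      π (onePlusPow z a) = Ideal.Quotient.mk J (1 + PadicInt.toZMod a • X z) :=
    Ideal.Quotient.eq.2 (Submodule.mem_sup_right (map_onePlusPow_sub_mem p hp z a ha))
  have hpow_one (z : ChevalleyVars b) (a : ℤ_[p]) (ha : PadicInt.toZMod a = 1) :
      π (onePlusPow z a) = 1 + v z := by
    rw [hpow z a (by simp [ha]), ha, one_smul, map_add, map_one]
  have hpow_zero (z : ChevalleyVars b) (a : ℤ_[p]) (ha : PadicInt.toZMod a = 0) :
      π (onePlusPow z a) = 1 := by
    rw [hpow z a (by simp [ha]), ha, zero_smul, add_zero, map_one]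
  suffices h : (1 + v x) * (1 + v y) = (1 + v y) * (1 + v x) by
    refine Ideal.Quotient.eq.1 ?_
    rw [map_mul, map_mul]
    exact mul_comm_of_one_add_mul_comm h
  have hpos (α : H.root) (hα : b.IsPos α) :
      (1 + v (.inl α)) * (1 + v (.inl (negRoot α))) =
        (1 + v (.inl (negRoot α))) * (1 + v (.inl α)) := by
    have h := hrel (.root_neg α hα)
    have hprod : π (List.ofFn fun i : Fin l => onePlusPow (.inr (δ i))
        ((D.corootConst p (fun k => (δ k : H.root)) α i : ℤ_[p]) * exponentP p)).prod = 1 := by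
      rw [map_list_prod]
      refine List.prod_eq_one fun z hz => ?_
      obtain ⟨_, h1, rfl⟩ := List.mem_map.1 hz
      obtain ⟨i, rfl⟩ := List.mem_ofFn.1 h1
      exact hpow_zero _ _ (by rw [map_mul, toZMod_exponentP p hp, mul_zero])
    rw [map_sub, map_mul, map_mul, map_mul, hprod, hpow_one _ _ (toZMod_exponentQ p),
      hpow_one _ _ (toZMod_exponentQ p), map_add, map_add, map_one, hX, hX, mul_one,
      sub_eq_zero] at h
    exact h
  have htorus (d : b.support) (α : H.root) :
      (1 + v (.inr d)) * (1 + v (.inl α)) = (1 + v (.inl α)) * (1 + v (.inr d)) := by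
    have h := hrel (.torus_root d α)
    rw [map_sub, map_mul, map_mul, hpow_one _ _ (toZMod_unitOnePlusP_zpow p _), map_add, map_add,
      map_one, hX, hX, sub_eq_zero] at h
    exact h
  rcases x with α | d <;> rcases y with β | d'
  · by_cases hne : (rootSystem H).root α + (rootSystem H).root β = 0
    · have hβ : β = negRoot α := (rootSystem H).root.injective
        (by rw [root_negRoot]; exact (neg_eq_of_add_eq_zero_right hne).symm)
      subst hβ
      rcases isPos_or_isPos_negRoot b α with hα | hα
      · exact hpos α hα
      · have h := hpos _ hα
        rw [negRoot_negRoot] at h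
        exact h.symm
    by_cases hadd : (rootSystem H).root α + (rootSystem H).root β ∈ Set.range (rootSystem H).root
    · have h := hrel (.root_root α β hne hadd)
      have hprod : π ((terms α β).map fun z => onePlusPow (.inl z.2.2)
            ((D.commConst p (terms α β) α β z.1 z.2.1 : ℤ_[p]) *
              (p : ℤ_[p]) ^ (z.1 + z.2.1 - 1))).prod = 1 := by
        rw [map_list_prod]
        refine List.prod_eq_one fun z hz => ?_
        obtain ⟨_, h1, rfl⟩ := List.mem_map.1 hz
        obtain ⟨⟨i, j, γ⟩, hi, rfl⟩ := List.mem_map.1 h1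
        obtain ⟨hi, hj, -⟩ := ((hterms α β hne).2 i j γ).1 hi
        refine hpow_zero _ _ ?_
        rw [map_mul, map_pow, map_natCast, ZMod.natCast_self, zero_pow (by dsimp only; omega),
          mul_zero]
      rw [map_sub, map_mul, map_mul, map_mul, hprod, map_add, map_add, map_one, hX, hX, one_mul,
        sub_eq_zero] at h
      exact h
    · have h := hrel (.root_comm α β hne hadd)
      rw [map_sub, map_mul, map_mul, map_add, map_add, map_one, hX, hX, sub_eq_zero] at h
      exact h
  · exact (htorus d' α).symm
  · exact htorus d β
  · have h := hrel (.torus_torus d d')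
    rw [map_sub, map_mul, map_mul, map_add, map_add, map_one, hX, hX, sub_eq_zero] at h
    exact h

end Relations

theorem mainTheorem5 (p : ℕ) [Fact p.Prime] (hp : p ≠ 2)
    {L : Type*} [LieRing L] [LieAlgebra ℂ L] [FiniteDimensional ℂ L] [LieAlgebra.IsSemisimple ℂ L]
    (H : LieSubalgebra ℂ L) [H.IsCartanSubalgebra]
    {V : Type*} [AddCommGroup V] [Module ℂ V] [LieRingModule L V] [LieModule ℂ L V]
    [LieModule.IsFaithful ℂ L V] {n : ℕ} (D : ChevalleyDatum H V n)
    (b : (LieAlgebra.IsKilling.rootSystem H).Base) {l : ℕ} (δ : Fin l ≃ b.support)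
    (terms : H.root → H.root → List (ℕ × ℕ × H.root)) (hterms : IsCommutatorOrdering H terms)
    (N : ℕ) :
    Module.rank (ZMod p) (grBbar p D b δ terms N) ≤
      Module.rank (ZMod p)
        (MvPolynomial.homogeneousSubmodule (ChevalleyVars b) (ZMod p) N) := by
  exact NCPowerSeries.rank_graded_quotient_le (idealRbar p D b δ terms)
    (commutator_mem_idealRbar_sup p D b δ terms hp hterms) (filtBbar p D b δ terms)
    (fun _ => rfl) N
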